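/- Permutations of length $n$ are words containing each of $1,\dots,n$ exactly once. The pattern $1423$ occurs in $\sigma$ at position $i$ if $i+3\le n$ and the consecutive entries $\sigma_i\sigma_{i+1}\sigma_{i+2}\sigma_{i+3}$ are in the same relative order as $1,4,2,3$. For $l\ge1$, an $l$-cluster of length $n$ is a tuple $(\sigma,i_1,\dots,i_l)$, where $\sigma$ is a permutation of length $n$ in which $1423$ occurs at each of the positions $i_1,\dots,i_l$, such that $i_1=1$, $i_j<i_{j+1}<i_j+4$ for $1\le j<l$, and $i_l+3=n$. By convention, the only $0$-cluster is the permutation of length $1$. Let $c_{n,l}$ be the number of $l$-clusters of length $n$ for $l\ge 0$, and put $c_{n,l}=0$ for $l<0$. Let $\pi_{n,k}$ be the number of permutations of length $n$ with exactly $k$ occurrences of $1423$. **Theorem.** For all $l\ge 0$ one has $c_{1,l}=\delta_{0,l}$, $c_{2,l}=0$, $c_{3,l}=0$, and for all $n\ge4$ and $l\ge0$ $$c_{n,l}=\sum_{4\le 2k+2\le n}\binom{n-k-2}{k}\,c_{n-2k-1,\,l-k}.$$ Moreover, in the ring $\mathbb{Q}[t][[x]]$ of formal power series in $x$ with polynomial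 coefficients in $t$, $$\sum_{n,k\ge0}\pi_{n,k}\frac{x^n}{n!}t^k=\left(1-x-\sum_{n\ge2,\,l\ge1}\frac{c_{n,l}\,x^n(t-1)^l}{n!}\right)^{-1}.$$ -/

import Mathlib

/-!  Consecutive patterns in permutations and Goulden-Jackson clusters for a single pattern.
A permutation of length `n` is an element `σ` of `Equiv.Perm (Fin n)`, read as the word
`σ 0, σ 1, …, σ (n-1)`; positions and entries are numbered from `0`.  -/

namespace ConsecutivePattern

/-- The pattern `τ` of length `m` occurs in `σ` at position `i`: the factor
`σ i, …, σ (i + m - 1)` exists and its standardization is `τ`, that is, its entries are in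
the same relative order as those of `τ`. -/
def OccursAt {m n : ℕ} (τ : Equiv.Perm (Fin m)) (σ : Equiv.Perm (Fin n)) (i : ℕ) : Prop :=
  ∃ h : i + m ≤ n, ∀ a b : Fin m,
    σ ⟨i + a, by omega⟩ < σ ⟨i + b, by omega⟩ ↔ τ a < τ b

/-- The number of (consecutive) occurrences of `τ` in `σ`. -/
noncomputable def numOccurrences {m n : ℕ} (τ : Equiv.Perm (Fin m))
    (σ : Equiv.Perm (Fin n)) : ℕ :=
  Nat.card {i : Fin n // OccursAt τ σ i}

/-- The number of permutations of length `n` with exactly `k` occurrences of `τ`. -/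
noncomputable def permCount {m : ℕ} (τ : Equiv.Perm (Fin m)) (n k : ℕ) : ℕ :=
  Nat.card {σ : Equiv.Perm (Fin n) // numOccurrences τ σ = k}

/-- `(σ, i 0, …, i (q-1))` is a `q`-cluster for the pattern `τ`: the marked positions carry
occurrences of `τ`, they are listed from left to right, consecutive marked occurrences
overlap, the first one starts at the first letter of `σ` and the last one ends at the last
letter of `σ`.  By convention the only `0`-cluster is the permutation of length `1`. -/
structure IsCluster {m n q : ℕ} (τ : Equiv.Perm (Fin m)) (σ : Equiv.Perm (Fin n))
    (i : Fin q → Fin n) : Prop where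
  occurs : ∀ k, OccursAt τ σ (i k)
  increasing : ∀ k l : Fin q, (l : ℕ) = k + 1 → i k < i l
  linked : ∀ k l : Fin q, (l : ℕ) = k + 1 → (i l : ℕ) < i k + m
  first : ∀ k : Fin q, (k : ℕ) = 0 → (i k : ℕ) = 0
  last : ∀ k : Fin q, (k : ℕ) + 1 = q → (i k : ℕ) + m = n
  empty : q = 0 → n = 1

/-- The cluster number: the number of `q`-clusters `(σ, i)` for `τ` with `σ` of length `n`. -/
noncomputable def clusterNumber {m : ℕ} (τ : Equiv.Perm (Fin m)) (n q : ℕ) : ℕ :=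
  Nat.card {c : Equiv.Perm (Fin n) × (Fin q → Fin n) // IsCluster τ c.1 c.2}

/-- The pattern `1423`. -/
def pattern1423 : Equiv.Perm (Fin 4) where
  toFun := ![0, 3, 1, 2]
  invFun := ![0, 2, 3, 1]
  left_inv := by decide
  right_inv := by decide

/-- A permutation of length `n` has at most `n` occurrences of a pattern; hence the sum over
`k ≤ n` in `occurrenceSeries` is the sum over all `k`. -/
theorem permCount_eq_zero {m : ℕ} (τ : Equiv.Perm (Fin m)) {n k : ℕ} (h : n < k) :
    permCount τ n k = 0 := by
  have : IsEmpty {σ : Equiv.Perm (Fin n) // numOccurrences τ σ = k} := by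
    refine ⟨fun ⟨σ, hσ⟩ => ?_⟩
    have h1 : numOccurrences τ σ ≤ n := by
      have := Nat.card_le_card_of_injective
        (fun x : {i : Fin n // OccursAt τ σ i} => x.1) Subtype.val_injective
      simpa [numOccurrences] using this
    omega
  exact Nat.card_of_isEmpty

/-- A cluster of length `n` has at most `n` marked occurrences; hence the sum over
`1 ≤ l ≤ n` in `shiftedClusterSeries` is the sum over all `l ≥ 1`. -/
theorem clusterNumber_eq_zero {m : ℕ} (τ : Equiv.Perm (Fin m)) {n q : ℕ} (h : n < q) :
    clusterNumber τ n q = 0 := by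
  have : IsEmpty {c : Equiv.Perm (Fin n) × (Fin q → Fin n) // IsCluster τ c.1 c.2} := by
    refine ⟨fun ⟨⟨σ, i⟩, hc⟩ => ?_⟩
    obtain ⟨p, rfl⟩ : ∃ p, q = p + 1 := ⟨q - 1, by omega⟩
    have hm : StrictMono i := Fin.strictMono_iff_lt_succ.2
      fun k => hc.increasing k.castSucc k.succ (by simp)
    have := Fintype.card_le_of_injective i hm.injective
    simp only [Fintype.card_fin] at this
    omega
  exact Nat.card_of_isEmpty

/-- The generating function for occurrences of `τ`, the formal power series in `x` with
polynomial coefficients in `t` given by the sum over `n, k` of `permCount τ n k * x^n / n! * t^k`. -/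
noncomputable def occurrenceSeries {m : ℕ} (τ : Equiv.Perm (Fin m)) :
    PowerSeries (Polynomial ℚ) :=
  PowerSeries.mk fun n => ∑ k ∈ Finset.range (n + 1),
    Polynomial.C ((permCount τ n k : ℚ) / (n.factorial : ℚ)) * Polynomial.X ^ k

/-- The formal power series in `x` with polynomial coefficients in `t` given by the sum over
`n ≥ 2, l ≥ 1` of `clusterNumber τ n l * x^n * (t - 1)^l / n!`. -/
noncomputable def shiftedClusterSeries {m : ℕ} (τ : Equiv.Perm (Fin m)) :
    PowerSeries (Polynomial ℚ) :=
  PowerSeries.mk fun n => if 2 ≤ n then ∑ l ∈ Finset.Icc 1 n,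
    Polynomial.C ((clusterNumber τ n l : ℚ) / (n.factorial : ℚ)) * (Polynomial.X - 1) ^ l
  else 0

end ConsecutivePattern

namespace ConsecutivePattern

/-! Occurrences at a set `S` of positions impose order relations on the letters, so the permutations
having them number the linear extensions of a relation on positions (`card_perm_occursAt`). Both
halves of the theorem follow from decomposing such relations into sums.

Generating function: `t ^ k = ((t - 1) + 1) ^ k` turns the count by occurrences into a sum over
permutations with a marked set `S` of occurrences, weighted by `(t - 1) ^ #S`. Cutting the word at
the first gap that no marked factor crosses leaves a block and an arbitrary marked remainder. The
two parts share no relation, so linear extensions multiply up to a binomial coefficient, which the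
`n!` absorb. Blocks with their permutations are the clusters, so `F = 1 + (x + C) F`.

Recurrence: an occurrence of 1423 at `i` says `σ i < σ (i+2) < σ (i+3) < σ (i+1)`. Marks at distance
one contradict each other, so linked marks are at distance two or three. Let `0, 2, …, 2k-2` be the
maximal initial run of marks at distance two; what remains is a cluster starting at letter `2k+1`.
The even letters `0, …, 2k` and letter `2k+1` form a chain below everything else. Above it lie the
`k` remaining odd letters, forming a chain, and the `n-2k-2` remaining letters of the second
cluster, with no relation between the two groups; this gives `(n-k-2).choose k`. -/

/-! ### Linear extensions of finite relations -/

/-- The number of linear extensions of a relation `r`: the number of strict total orders that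
contain `r`. -/
noncomputable def linExt {X : Type} (r : X → X → Prop) : ℕ :=
  Nat.card {s : X → X → Prop // IsStrictTotalOrder X s ∧ ∀ x y, r x y → s x y}

theorem isStrictTotalOrder_comap {X Y : Type} {f : X → Y} (hf : Function.Injective f)
    {s : Y → Y → Prop} (hs : IsStrictTotalOrder Y s) :
    IsStrictTotalOrder X (fun x y => s (f x) (f y)) where
  irrefl x := hs.irrefl (f x)
  trans x y z := hs.trans (f x) (f y) (f z)
  trichotomous x y h1 h2 := hf (hs.trichotomous (f x) (f y) h1 h2)

/-- Finite total orders are well-orders, hence determined up to isomorphism by cardinality, and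
isomorphisms of well-orders are unique. -/
theorem existsUnique_perm {X : Type} [Finite X] {s t : X → X → Prop}
    (hs : IsStrictTotalOrder X s) (ht : IsStrictTotalOrder X t) :
    ∃! p : Equiv.Perm X, ∀ x y, s x y ↔ t (p x) (p y) := by
  have : Fintype X := Fintype.ofFinite X
  have h : IsWellOrder X s := { toIsWellFounded := ⟨Finite.wellFounded_of_trans_of_irrefl s⟩ }
  have h' : IsWellOrder X t := { toIsWellFounded := ⟨Finite.wellFounded_of_trans_of_irrefl t⟩ }
  have key : Ordinal.type s = Ordinal.type t := by
    rw [Ordinal.type_fintype, Ordinal.type_fintype]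
  obtain ⟨e⟩ := Ordinal.type_eq.1 key
  refine ⟨e.toEquiv, fun x y => (e.map_rel_iff (a := x) (b := y)).symm, fun p hp => ?_⟩
  let e' : s ≃r t := ⟨p, fun {a b} => (hp a b).symm⟩
  exact Equiv.ext fun x => InitialSeg.eq e'.toInitialSeg e.toInitialSeg x

theorem card_perm_eq_linExt {X : Type} [Finite X] {t : X → X → Prop}
    (ht : IsStrictTotalOrder X t) (r : X → X → Prop) :
    Nat.card {p : Equiv.Perm X // ∀ x y, r x y → t (p x) (p y)} = linExt r := by
  refine Nat.card_eq_of_bijective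
    (fun p => ⟨fun x y => t (p.1 x) (p.1 y), isStrictTotalOrder_comap p.1.injective ht, p.2⟩)
    ⟨fun p q h => ?_, fun s => ?_⟩
  · have h' : ∀ x y, t (p.1 x) (p.1 y) ↔ t (q.1 x) (q.1 y) := fun x y =>
      iff_of_eq (congrFun (congrFun (congrArg Subtype.val h) x) y)
    exact Subtype.ext ((existsUnique_perm (isStrictTotalOrder_comap p.1.injective ht) ht).unique
      (fun _ _ => Iff.rfl) h')
  · obtain ⟨p, hp, -⟩ := existsUnique_perm s.2.1 ht
    exact ⟨⟨p, fun x y h => (hp x y).1 (s.2.2 x y h)⟩,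
      Subtype.ext (funext fun x => funext fun y => propext (hp x y).symm)⟩

/-- Only the total orders containing the two relations are compared, so the relations may differ as
long as they force the same comparisons; no transitive closure has to be computed. -/
theorem linExt_congr {X Y : Type} (e : X ≃ Y) {r : X → X → Prop} {r' : Y → Y → Prop}
    (h : ∀ s : Y → Y → Prop, IsStrictTotalOrder Y s →
      ((∀ x y, r x y → s (e x) (e y)) ↔ ∀ x y, r' x y → s x y)) :
    linExt r = linExt r' := by
  symm
  refine Nat.card_eq_of_bijective (fun s => ⟨fun x y => s.1 (e x) (e y),
    isStrictTotalOrder_comap e.injective s.2.1, (h s.1 s.2.1).2 s.2.2⟩) ⟨fun s t hst => ?_, ?_⟩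
  · refine Subtype.ext (funext fun x => funext fun y => ?_)
    have := congrFun (congrFun (congrArg Subtype.val hst) (e.symm x)) (e.symm y)
    simpa using this
  · rintro ⟨s, hs, hr⟩
    have hs' : IsStrictTotalOrder Y (fun x y => s (e.symm x) (e.symm y)) :=
      isStrictTotalOrder_comap e.symm.injective hs
    exact ⟨⟨_, hs', (h _ hs').1 (by simpa using hr)⟩, by simp⟩

/-- A chain placed below everything is already totally ordered, so an extension is determined by its
restriction to `Y`. -/
theorem linExt_ordinalSum {Y : Type} (k : ℕ) (r : Y → Y → Prop) :
    linExt (Sum.Lex (fun i j : Fin k => i < j) r) = linExt r := by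
  symm
  refine Nat.card_eq_of_bijective (fun s => ⟨Sum.Lex (fun i j : Fin k => i < j) s.1, ?_, ?_⟩)
    ⟨fun s t hst => ?_, ?_⟩
  · have := s.2.1
    exact { }
  · intro x y h
    exact h.mono (fun _ _ h => h) s.2.2
  · refine Subtype.ext (funext fun x => funext fun y => ?_)
    have := congrFun (congrFun (congrArg Subtype.val hst) (Sum.inr x)) (Sum.inr y)
    simpa using this
  · rintro ⟨s, hs, hr⟩
    refine ⟨⟨fun x y => s (Sum.inr x) (Sum.inr y), isStrictTotalOrder_comap Sum.inr_injective hs,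
      fun x y h => hr _ _ (Sum.Lex.inr h)⟩, Subtype.ext (funext fun x => funext fun y => ?_)⟩
    refine propext ⟨fun h => ?_, fun h => ?_⟩
    · rcases h with h | h | h
      · exact hr _ _ (Sum.Lex.inl h)
      · exact h
      · exact hr _ _ (Sum.Lex.sep _ _)
    · rcases x with x | x <;> rcases y with y | y
      · refine Sum.lex_inl_inl.2 ?_
        by_contra hxy
        rcases (not_lt.1 hxy).lt_or_eq with h' | rfl
        · exact hs.irrefl _ (hs.trans _ _ _ h (hr _ _ (Sum.Lex.inl h')))
        · exact hs.irrefl _ h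
      · exact Sum.Lex.sep _ _
      · exact absurd (hs.trans _ _ _ h (hr _ _ (Sum.Lex.sep _ _))) (hs.irrefl _)
      · simpa using h

theorem card_strictTotalOrder (X : Type) [Fintype X] :
    Nat.card {s : X → X → Prop // IsStrictTotalOrder X s} = (Fintype.card X).factorial := by
  classical
  have ht : IsStrictTotalOrder X (fun x y => Fintype.equivFin X x < Fintype.equivFin X y) :=
    isStrictTotalOrder_comap (Fintype.equivFin X).injective inferInstance
  have := card_perm_eq_linExt ht (fun _ _ => False)
  simp only [linExt, false_imp_iff, implies_true, and_true] at this
  rw [← this, ← Fintype.card_perm, ← Nat.card_eq_fintype_card]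
  exact Nat.card_congr (Equiv.subtypeUnivEquiv fun _ => trivial)

/-- Double counting: an extension `s` of the disjoint sum together with permutations `p`, `q` of the
summands corresponds to an arbitrary total order (the pullback of `s` along `p ⊕ q`) together with
the two restrictions of `s`. Conversely, `p` and `q` are recovered as the unique isomorphisms
between restrictions. -/
theorem linExt_liftRel_mul {X Y : Type} [Fintype X] [Fintype Y]
    (r : X → X → Prop) (r' : Y → Y → Prop) :
    linExt (Sum.LiftRel r r') * ((Fintype.card X).factorial * (Fintype.card Y).factorial) =
      (Fintype.card X + Fintype.card Y).factorial * (linExt r * linExt r') := by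
  classical
  rw [← Fintype.card_sum, ← card_strictTotalOrder (X ⊕ Y), ← Fintype.card_perm (α := X),
    ← Fintype.card_perm (α := Y), ← Nat.card_eq_fintype_card,
    ← Nat.card_eq_fintype_card, linExt, linExt, linExt, ← Nat.card_prod, ← Nat.card_prod, ← Nat.card_prod, ← Nat.card_prod]
  refine Nat.card_eq_of_bijective (fun z =>
    (⟨fun x y => z.1.1 (Equiv.sumCongr z.2.1 z.2.2 x) (Equiv.sumCongr z.2.1 z.2.2 y),
      isStrictTotalOrder_comap (Equiv.injective _) z.1.2.1⟩,
     ⟨fun x y => z.1.1 (Sum.inl x) (Sum.inl y),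
      isStrictTotalOrder_comap Sum.inl_injective z.1.2.1,
      fun x y h => z.1.2.2 _ _ (Sum.LiftRel.inl h)⟩,
     ⟨fun x y => z.1.1 (Sum.inr x) (Sum.inr y),
      isStrictTotalOrder_comap Sum.inr_injective z.1.2.1,
      fun x y h => z.1.2.2 _ _ (Sum.LiftRel.inr h)⟩)) ⟨?_, ?_⟩
  · rintro ⟨⟨s, hs, hr⟩, p, q⟩ ⟨⟨t, ht, hr'⟩, p', q'⟩ h
    simp only [Prod.mk.injEq, Subtype.mk.injEq, funext_iff, eq_iff_iff] at h
    obtain ⟨h0, h1, h2⟩ := h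
    have hp : p = p' := (existsUnique_perm
      (isStrictTotalOrder_comap (Sum.inl_injective.comp p.injective : Function.Injective
        fun x => Sum.inl (p x)) hs) (isStrictTotalOrder_comap Sum.inl_injective hs)).unique
      (fun _ _ => Iff.rfl) (fun x y => by
        have := h0 (Sum.inl x) (Sum.inl y)
        simp only [Equiv.sumCongr_apply, Sum.map_inl] at this
        exact this.trans (h1 _ _).symm)
    have hq : q = q' := (existsUnique_perm
      (isStrictTotalOrder_comap (Sum.inr_injective.comp q.injective : Function.Injective
        fun x => Sum.inr (q x)) hs) (isStrictTotalOrder_comap Sum.inr_injective hs)).unique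
      (fun _ _ => Iff.rfl) (fun x y => by
        have := h0 (Sum.inr x) (Sum.inr y)
        simp only [Equiv.sumCongr_apply, Sum.map_inr] at this
        exact this.trans (h2 _ _).symm)
    subst hp hq
    have : s = t := by
      funext x y
      have := h0 ((Equiv.sumCongr p q).symm x) ((Equiv.sumCongr p q).symm y)
      simpa only [Equiv.apply_symm_apply, eq_iff_iff] using this
    subst this
    rfl
  · rintro ⟨⟨s', hs'⟩, ⟨s1, hs1, hr1⟩, ⟨s2, hs2, hr2⟩⟩
    obtain ⟨p, hp, -⟩ := existsUnique_perm (isStrictTotalOrder_comap Sum.inl_injective hs') hs1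
    obtain ⟨q, hq, -⟩ := existsUnique_perm (isStrictTotalOrder_comap Sum.inr_injective hs') hs2
    refine ⟨(⟨fun x y => s' ((Equiv.sumCongr p q).symm x) ((Equiv.sumCongr p q).symm y),
      isStrictTotalOrder_comap (Equiv.injective _) hs', ?_⟩, p, q), ?_⟩
    · rintro x y (h | h)
      · simpa [hp] using hr1 _ _ h
      · simpa [hq] using hr2 _ _ h
    · simp only [Prod.mk.injEq, Subtype.mk.injEq, funext_iff, eq_iff_iff]
      refine ⟨by simp, fun x y => ?_, fun x y => ?_⟩
      · simp [hp]
      · simp [hq]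

theorem linExt_liftRel {X Y : Type} [Fintype X] [Fintype Y]
    (r : X → X → Prop) (r' : Y → Y → Prop) :
    linExt (Sum.LiftRel r r') =
      (Fintype.card X + Fintype.card Y).choose (Fintype.card X) * (linExt r * linExt r') := by
  have h := linExt_liftRel_mul r r'
  rw [← Nat.add_choose_mul_factorial_mul_factorial, ← Nat.choose_symm_add] at h
  refine Nat.eq_of_mul_eq_mul_right (Nat.mul_pos (Nat.factorial_pos (Fintype.card X))
    (Nat.factorial_pos (Fintype.card Y))) (h.trans ?_)
  ring

theorem linExt_of_isEmpty {X : Type} [IsEmpty X] (r : X → X → Prop) : linExt r = 1 := by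
  have : Unique {s : X → X → Prop // IsStrictTotalOrder X s ∧ ∀ x y, r x y → s x y} :=
    { default := ⟨fun x => isEmptyElim x,
        ⟨{ trichotomous := fun x => isEmptyElim x
           irrefl := fun x => isEmptyElim x
           trans := fun x => isEmptyElim x }, fun x => isEmptyElim x⟩⟩
      uniq := fun s => Subtype.ext (funext fun x => isEmptyElim x) }
  exact Nat.card_unique

theorem linExt_chain (k : ℕ) : linExt (fun i j : Fin k => i < j) = 1 := by
  rw [← linExt_of_isEmpty (fun _ _ : Empty => False),
    ← linExt_ordinalSum k (fun _ _ : Empty => False)]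
  refine linExt_congr (Equiv.sumEmpty (Fin k) Empty).symm fun s _ => ⟨?_, ?_⟩
  · rintro h _ _ (h' | h' | h')
    · exact h _ _ h'
    · exact h'.elim
    · rename_i b
      exact b.elim
  · intro h x y hxy
    exact h _ _ (Sum.Lex.inl hxy)

/-! ### Marked positions and blocks -/

open Finset

/-- The order relations between positions that are forced by occurrences of `τ` at all positions
in `S`. -/
def OccRel {m : ℕ} (τ : Equiv.Perm (Fin m)) (S : Finset ℕ) (x y : ℕ) : Prop :=
  ∃ i ∈ S, ∃ a b : Fin m, τ a < τ b ∧ x = i + a ∧ y = i + b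

/-- The number of permutations of length `n` in which `τ` occurs at all positions in `S`. -/
noncomputable def markCount {m : ℕ} (τ : Equiv.Perm (Fin m)) (n : ℕ) (S : Finset ℕ) : ℕ :=
  linExt (fun x y : Fin n => OccRel τ S x y)

/-- The sets of positions at which a pattern of length `m` fits into a word of length `n`. -/
def markSets (m n : ℕ) : Finset (Finset ℕ) := (range (n + 1 - m)).powerset

open Classical in
/-- The sets of positions such that the marked factors of length `m` cover every gap between two
adjacent letters of a nonempty word of length `n`. -/
noncomputable def blocks (m n : ℕ) : Finset (Finset ℕ) :=
  {S ∈ markSets m n | 0 < n ∧ ∀ p, 0 < p → p < n → ∃ x ∈ S, x < p ∧ p < x + m}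

/-- The translate of `S` by `a`. -/
abbrev shift (a : ℕ) (S : Finset ℕ) : Finset ℕ := S.map (addLeftEmbedding a)

theorem mem_shift {a x : ℕ} {S : Finset ℕ} : x ∈ shift a S ↔ ∃ y ∈ S, a + y = x := by
  simp [shift]

theorem mem_markSets {m n : ℕ} {S : Finset ℕ} :
    S ∈ markSets m n ↔ ∀ x ∈ S, x < n + 1 - m := by
  simp [markSets, subset_iff]

theorem mem_blocks {m n : ℕ} {S : Finset ℕ} :
    S ∈ blocks m n ↔ S ∈ markSets m n ∧ 0 < n ∧
      ∀ p, 0 < p → p < n → ∃ x ∈ S, x < p ∧ p < x + m := by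
  simp [blocks]

theorem add_le_of_mem_markSets {m n x : ℕ} {S : Finset ℕ} (h : S ∈ markSets m n) (hx : x ∈ S) :
    x + m ≤ n := by
  have := mem_markSets.1 h x hx
  omega

/-- Both sides being linear orders, preserving strict inequalities already reflects them. -/
theorem occursAt_iff {m n : ℕ} (τ : Equiv.Perm (Fin m)) (σ : Equiv.Perm (Fin n)) {i : ℕ}
    (hi : i + m ≤ n) :
    OccursAt τ σ i ↔ ∀ a b : Fin m, τ a < τ b →
      σ ⟨i + a, by omega⟩ < σ ⟨i + b, by omega⟩ := by
  refine ⟨fun ⟨_, h⟩ a b => (h a b).2, fun h => ⟨hi, fun a b => ⟨fun hab => ?_, h a b⟩⟩⟩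
  rcases lt_trichotomy (τ a) (τ b) with h' | h' | h'
  · exact h'
  · rw [τ.injective h'] at hab
    exact absurd hab (lt_irrefl _)
  · exact absurd (hab.trans (h b a h')) (lt_irrefl _)

theorem card_perm_occursAt {m n : ℕ} (τ : Equiv.Perm (Fin m)) {S : Finset ℕ}
    (hS : S ∈ markSets m n) :
    Nat.card {σ : Equiv.Perm (Fin n) // ∀ i ∈ S, OccursAt τ σ i} = markCount τ n S := by
  rw [markCount, ← card_perm_eq_linExt (t := fun x y : Fin n => x < y) inferInstance]
  refine Nat.card_congr (Equiv.subtypeEquivRight fun σ => ⟨fun h => ?_, fun h i hi => ?_⟩)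
  · rintro ⟨_, hx⟩ ⟨_, hy⟩ ⟨i, hi, a, b, hab, rfl, rfl⟩
    exact (occursAt_iff τ σ (add_le_of_mem_markSets hS hi)).1 (h i hi) a b hab
  · exact (occursAt_iff τ σ (add_le_of_mem_markSets hS hi)).2
      fun a b hab => h _ _ ⟨i, hi, a, b, hab, rfl, rfl⟩

theorem markCount_union {m a b : ℕ} (τ : Equiv.Perm (Fin m)) {S₁ : Finset ℕ} (S₂ : Finset ℕ)
    (h₁ : S₁ ∈ markSets m a) :
    markCount τ (a + b) (S₁ ∪ shift a S₂) =
      (a + b).choose a * (markCount τ a S₁ * markCount τ b S₂) := by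
  have := linExt_liftRel (fun x y : Fin a => OccRel τ S₁ x y) (fun x y : Fin b => OccRel τ S₂ x y)
  simp only [Fintype.card_fin] at this
  rw [markCount, markCount, markCount, ← this]
  symm
  refine linExt_congr finSumFinEquiv fun s _ => ⟨fun h x y => ?_, fun h => ?_⟩
  · rintro ⟨i, hi, c, d, hcd, hx, hy⟩
    rcases mem_union.1 hi with hi | hi
    · have := add_le_of_mem_markSets h₁ hi
      have := h (Sum.inl ⟨i + c, by omega⟩) (Sum.inl ⟨i + d, by omega⟩)
        (Sum.LiftRel.inl ⟨i, hi, c, d, hcd, rfl, rfl⟩)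
      convert this using 1
      · exact Fin.ext hx
      · exact Fin.ext hy
    · obtain ⟨j, hj, rfl⟩ := mem_shift.1 hi
      have := h (Sum.inr ⟨j + c, by omega⟩) (Sum.inr ⟨j + d, by omega⟩)
        (Sum.LiftRel.inr ⟨j, hj, c, d, hcd, rfl, rfl⟩)
      convert this using 1
      · exact Fin.ext (by simp; omega)
      · exact Fin.ext (by simp; omega)
  · rintro _ _ (⟨i, hi, c, d, hcd, hx, hy⟩ | ⟨i, hi, c, d, hcd, hx, hy⟩)
    · exact h _ _ ⟨i, mem_union_left _ hi, c, d, hcd, by simpa using hx, by simpa using hy⟩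
    · exact h _ _ ⟨a + i, mem_union_right _ (mem_shift.2 ⟨i, hi, rfl⟩), c, d, hcd,
        by simp; omega, by simp; omega⟩

/-! ### Clusters as permutations with a block of marks -/

theorem linked_of_mem_blocks {m n x y : ℕ} {S : Finset ℕ} (hS : S ∈ blocks m n)
    (hy : y ∈ S) (hm : 0 < m) (h : ∀ z ∈ S, x < z → y ≤ z) : y < x + m := by
  by_contra! hxy
  have := add_le_of_mem_markSets (mem_blocks.1 hS).1 hy
  -- The factor at `x` ends at gap `x + m`, so a mark crossing that gap starts after `x` but before
  -- `x + m`.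
  obtain ⟨z, hz, h1, h2⟩ := (mem_blocks.1 hS).2.2 (x + m) (by omega) (by omega)
  have := h z hz (by omega)
  omega

theorem last_of_mem_blocks {m n x : ℕ} {S : Finset ℕ} (hS : S ∈ blocks m n) (hx : x ∈ S)
    (hm : 0 < m) (h : ∀ z ∈ S, z ≤ x) : x + m = n := by
  by_contra! hxy
  have := add_le_of_mem_markSets (mem_blocks.1 hS).1 hx
  obtain ⟨z, hz, h1, h2⟩ := (mem_blocks.1 hS).2.2 (x + m) (by omega) (by omega)
  have := h z hz
  omega

theorem zero_mem_of_mem_blocks {m n : ℕ} {S : Finset ℕ} (hS : S ∈ blocks m n) (hn : 2 ≤ n) :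
    0 ∈ S := by
  obtain ⟨z, hz, h1, h2⟩ := (mem_blocks.1 hS).2.2 1 (by omega) (by omega)
  rwa [Nat.lt_one_iff.1 h1] at hz

theorem isCluster_orderEmbOfFin {m n q : ℕ} (hm : 2 ≤ m) {τ : Equiv.Perm (Fin m)}
    {σ : Equiv.Perm (Fin n)} {S : Finset ℕ} (hS : S ∈ blocks m n) (hq : #S = q)
    (hσ : ∀ i ∈ S, OccursAt τ σ i) (hlt : ∀ k, S.orderEmbOfFin hq k < n) :
    IsCluster τ σ (fun k => ⟨S.orderEmbOfFin hq k, hlt k⟩) where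
  occurs k := hσ _ (S.orderEmbOfFin_mem hq k)
  increasing k l h := (S.orderEmbOfFin hq).strictMono (by rw [Fin.lt_def]; omega)
  linked k l h := by
    refine linked_of_mem_blocks hS (S.orderEmbOfFin_mem hq l)
      (by omega) fun z hz hlt => ?_
    obtain ⟨j, rfl⟩ : z ∈ Set.range (S.orderEmbOfFin hq) := by simpa using hz
    have := (S.orderEmbOfFin hq).lt_iff_lt.1 hlt
    exact (S.orderEmbOfFin hq).monotone (by rw [Fin.lt_def] at this; rw [Fin.le_def]; omega)
  first k h := by
    have := add_le_of_mem_markSets (mem_blocks.1 hS).1 (S.orderEmbOfFin_mem hq k)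
    have h0 := zero_mem_of_mem_blocks hS (by omega)
    obtain ⟨j, hj⟩ : 0 ∈ Set.range (S.orderEmbOfFin hq) := by simpa using h0
    have : S.orderEmbOfFin hq k ≤ S.orderEmbOfFin hq j :=
      (S.orderEmbOfFin hq).monotone (by rw [Fin.le_def]; omega)
    simp only
    omega
  last k h := by
    refine last_of_mem_blocks hS (S.orderEmbOfFin_mem hq k) (by omega) fun z hz => ?_
    obtain ⟨j, rfl⟩ : z ∈ Set.range (S.orderEmbOfFin hq) := by simpa using hz
    exact (S.orderEmbOfFin hq).monotone (by rw [Fin.le_def]; omega)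
  empty h := by
    by_contra hn
    have := (mem_blocks.1 hS).2.1
    have := card_pos.2 ⟨0, zero_mem_of_mem_blocks hS (by omega)⟩
    omega

theorem IsCluster.strictMono {m n q : ℕ} {τ : Equiv.Perm (Fin m)} {σ : Equiv.Perm (Fin n)}
    {i : Fin q → Fin n} (h : IsCluster τ σ i) : StrictMono i := by
  cases q with
  | zero => exact fun x => x.elim0
  | succ p => exact Fin.strictMono_iff_lt_succ.2 fun k => h.increasing k.castSucc k.succ (by simp)

theorem IsCluster.image_mem_blocks {m n q : ℕ} {τ : Equiv.Perm (Fin m)} {σ : Equiv.Perm (Fin n)}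
    {i : Fin q → Fin n} (h : IsCluster τ σ i) :
    univ.image (fun k => (i k : ℕ)) ∈ blocks m n := by
  have hocc (k) : (i k : ℕ) + m ≤ n := (h.occurs k).1
  rw [mem_blocks, mem_markSets]
  refine ⟨fun x hx => ?_, ?_, fun p hp hpn => ?_⟩
  · obtain ⟨k, -, rfl⟩ := mem_image.1 hx
    have := hocc k
    omega
  · rcases Nat.eq_zero_or_pos q with hq | hq
    · have := h.empty hq
      omega
    · exact (i ⟨0, hq⟩).pos
  · have hq : 0 < q := by
      by_contra hq
      have := h.empty (by omega)
      omega
    -- The last mark starting before `p` covers gap `p`: the next mark is linked to it, or it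
    -- reaches the end of the word.
    obtain ⟨j, hj, hmax⟩ := exists_max_image ({k | (i k : ℕ) < p} : Finset (Fin q)) id
      ⟨⟨0, hq⟩, by simp [h.first ⟨0, hq⟩ rfl, hp]⟩
    refine ⟨i j, mem_image_of_mem _ (mem_univ _), (mem_filter.1 hj).2, ?_⟩
    by_contra! hjp
    rcases Nat.lt_or_ge (j + 1) q with hjq | hjq
    · have h1 := h.linked j ⟨j + 1, hjq⟩ rfl
      have h2 := hmax ⟨j + 1, hjq⟩ (by simp; omega)
      simp [Fin.le_def] at h2
    · have := h.last j (by omega)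
      omega

/-- The increasing tuple of marks is determined by its set, and the linking conditions say exactly
that this set is a block. -/
theorem clusterNumber_eq_sum {m : ℕ} (hm : 2 ≤ m) (τ : Equiv.Perm (Fin m)) (n q : ℕ) :
    clusterNumber τ n q = ∑ S ∈ blocks m n with #S = q, markCount τ n S := by
  have hsum : ∑ S ∈ blocks m n with #S = q, markCount τ n S =
      ∑ S ∈ blocks m n with #S = q,
        Nat.card {σ : Equiv.Perm (Fin n) // ∀ i ∈ S, OccursAt τ σ i} :=
    sum_congr rfl fun S hS =>
      (card_perm_occursAt τ (mem_blocks.1 (mem_filter.1 hS).1).1).symm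
  rw [hsum, ← sum_coe_sort, ← Nat.card_sigma, clusterNumber]
  symm
  have hlt (S : Finset ℕ) (hS : S ∈ blocks m n) (hq : #S = q) (k) :
      S.orderEmbOfFin hq k < n := by
    have := add_le_of_mem_markSets (mem_blocks.1 hS).1 (S.orderEmbOfFin_mem hq k)
    omega
  refine Nat.card_eq_of_bijective (fun z => ⟨(z.2.1, fun k =>
    ⟨z.1.1.orderEmbOfFin (mem_filter.1 z.1.2).2 k, hlt _ (mem_filter.1 z.1.2).1 _ k⟩),
    isCluster_orderEmbOfFin hm (mem_filter.1 z.1.2).1 (mem_filter.1 z.1.2).2 z.2.2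
      (hlt _ (mem_filter.1 z.1.2).1 _)⟩) ⟨?_, ?_⟩
  · rintro ⟨⟨S, hS⟩, σ, hσ⟩ ⟨⟨T, hT⟩, σ', hσ'⟩ h
    simp only [Subtype.mk.injEq, Prod.mk.injEq, funext_iff, Fin.mk.injEq] at h
    obtain ⟨rfl, h⟩ := h
    have : S = T := by
      rw [← coe_inj, ← range_orderEmbOfFin S (mem_filter.1 hS).2,
        ← range_orderEmbOfFin T (mem_filter.1 hT).2]
      exact congrArg Set.range (funext h)
    subst this
    rfl
  · rintro ⟨⟨σ, i⟩, h⟩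
    have hinj : Function.Injective (fun k => (i k : ℕ)) := fun k l hkl =>
      h.strictMono.injective (Fin.ext hkl)
    have hcard : #(univ.image (fun k => (i k : ℕ))) = q := by
      rw [card_image_of_injective _ hinj, card_univ, Fintype.card_fin]
    refine ⟨⟨⟨univ.image (fun k => (i k : ℕ)),
      mem_filter.2 ⟨h.image_mem_blocks, hcard⟩⟩, σ, ?_⟩, ?_⟩
    · intro x hx
      obtain ⟨k, -, rfl⟩ := mem_image.1 hx
      exact h.occurs k
    · refine Subtype.ext (Prod.ext rfl (funext fun k => Fin.ext ?_))
      exact (congrFun (orderEmbOfFin_unique hcard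
        (fun k => mem_image_of_mem _ (mem_univ k)) h.strictMono) k).symm

/-! ### Splitting off the first block; the cluster method -/

theorem sum_markSets {A : Type*} [AddCommMonoid A] {m n : ℕ} (hm : 0 < m) (hn : 0 < n)
    (f : Finset ℕ → A) :
    ∑ S ∈ markSets m n, f S =
      ∑ z ∈ antidiagonal n, ∑ S₁ ∈ blocks m z.1, ∑ S₂ ∈ markSets m z.2,
        f (S₁ ∪ shift z.1 S₂) := by
  simp_rw [← sum_product', sum_sigma']
  symm
  refine sum_bij (fun z _ => z.2.1 ∪ shift z.1.1 z.2.2) ?_ ?_ ?_ (fun _ _ => rfl)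
  · rintro ⟨⟨a, b⟩, S₁, S₂⟩ h
    simp only [mem_sigma, HasAntidiagonal.mem_antidiagonal, mem_product] at h
    obtain ⟨rfl, h1, h2⟩ := h
    refine mem_markSets.2 fun x hx => ?_
    rcases mem_union.1 hx with hx | hx
    · have := mem_markSets.1 (mem_blocks.1 h1).1 x hx
      omega
    · obtain ⟨y, hy, rfl⟩ := mem_shift.1 hx
      have := mem_markSets.1 h2 y hy
      dsimp only at this ⊢
      omega
  -- The cut is unique: if `a < a'`, the block `T₁` has a mark crossing gap `a`, which no mark of
  -- `S₁ ∪ shift a S₂` does.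
  · have key : ∀ {a a' : ℕ} {S₁ S₂ T₁ T₂ : Finset ℕ}, S₁ ∈ blocks m a →
        T₁ ∈ blocks m a' →
        S₁ ∪ shift a S₂ = T₁ ∪ shift a' T₂ → a' ≤ a := by
      intro a a' S₁ S₂ T₁ T₂ h1 h1' h
      by_contra! haa
      obtain ⟨x, hx, hxa, hax⟩ := (mem_blocks.1 h1').2.2 a (mem_blocks.1 h1).2.1 haa
      have hx' := mem_union_left (shift a' T₂) hx
      rw [← h] at hx'
      rcases mem_union.1 hx' with hx | hx
      · have := add_le_of_mem_markSets (mem_blocks.1 h1).1 hx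
        omega
      · obtain ⟨y, hy, rfl⟩ := mem_shift.1 hx
        omega
    rintro ⟨⟨a, b⟩, S₁, S₂⟩ h ⟨⟨a', b'⟩, T₁, T₂⟩ h' heq
    simp only [mem_sigma, HasAntidiagonal.mem_antidiagonal, mem_product] at h h'
    obtain ⟨hab, h1, h2⟩ := h
    obtain ⟨hab', h1', h2'⟩ := h'
    dsimp only at heq
    obtain rfl : a = a' := le_antisymm (key h1' h1 heq.symm) (key h1 h1' heq)
    obtain rfl : b = b' := by omega
    have lt₁ : ∀ {T : Finset ℕ}, T ∈ blocks m a → ∀ x ∈ T, x < a := fun hT x hx => by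
      have := add_le_of_mem_markSets (mem_blocks.1 hT).1 hx
      omega
    have e1 : S₁ = T₁ := by
      ext x
      have hx := Finset.ext_iff.1 heq x
      have hs := lt₁ h1 x
      have ht := lt₁ h1' x
      simp only [mem_union, mem_shift] at hx
      constructor
      · intro h
        rcases hx.1 (Or.inl h) with h' | ⟨y, -, rfl⟩
        · exact h'
        · have := hs h
          omega
      · intro h
        rcases hx.2 (Or.inl h) with h' | ⟨y, -, rfl⟩
        · exact h'
        · have := ht h
          omega
    have e2 : S₂ = T₂ := by
      ext x
      have hx := Finset.ext_iff.1 heq (a + x)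
      have hs := lt₁ h1 (a + x)
      have ht := lt₁ h1' (a + x)
      simp only [mem_union, mem_shift, add_right_inj, exists_eq_right] at hx
      constructor
      · intro h
        rcases hx.1 (Or.inr h) with h' | h'
        · have := ht h'
          omega
        · exact h'
      · intro h
        rcases hx.2 (Or.inr h) with h' | h'
        · have := hs h'
          omega
        · exact h'
    rw [e1, e2]
  · intro S hS
    -- The cut is made at the least positive gap crossed by no mark; the end of the word always
    -- qualifies.
    have hex : ∃ a, 0 < a ∧ ∀ x ∈ S, x < a → x + m ≤ a :=
      ⟨n, hn, fun x hx _ => add_le_of_mem_markSets hS hx⟩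
    classical
    obtain ⟨ha, hbr⟩ := Nat.find_spec hex
    have hmin : ∀ p < Nat.find hex, 0 < p → ∃ x ∈ S, x < p ∧ p < x + m := fun p hp hp0 => by
      have := Nat.find_min hex hp
      push Not at this
      exact this hp0
    have han : Nat.find hex ≤ n :=
      Nat.find_min' hex ⟨hn, fun x hx _ => add_le_of_mem_markSets hS hx⟩
    generalize Nat.find hex = a at *
    refine ⟨⟨(a, n - a), {x ∈ S | x < a}, {x ∈ range n | a + x ∈ S}⟩, ?_, ?_⟩
    · simp only [mem_sigma, HasAntidiagonal.mem_antidiagonal, mem_product, mem_blocks,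
        mem_markSets, mem_filter]
      refine ⟨by omega, ⟨fun x hx => ?_, ha, fun p hp hpa => ?_⟩, fun x hx => ?_⟩
      · have := hbr x hx.1 hx.2
        omega
      · obtain ⟨x, hx, h1, h2⟩ := hmin p hpa hp
        exact ⟨x, ⟨hx, h1.trans hpa⟩, h1, h2⟩
      · have := add_le_of_mem_markSets hS hx.2
        omega
    · ext x
      simp only [mem_union, mem_shift, mem_filter, mem_range]
      constructor
      · rintro (h | ⟨y, h, rfl⟩)
        · exact h.1
        · exact h.2
      · intro h
        rcases Nat.lt_or_ge x a with hx | hx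
        · exact Or.inl ⟨h, hx⟩
        · have := add_le_of_mem_markSets hS h
          exact Or.inr ⟨x - a, ⟨by omega, by rwa [Nat.add_sub_cancel' hx]⟩, by omega⟩

/-- The contribution of the set `S` of marked positions to the cluster expansion. -/
noncomputable def markWeight {m : ℕ} (τ : Equiv.Perm (Fin m)) (n : ℕ) (S : Finset ℕ) :
    Polynomial ℚ :=
  Polynomial.C ((markCount τ n S : ℚ) / (n.factorial : ℚ)) * (Polynomial.X - 1) ^ #S

theorem markWeight_union {m a b : ℕ} (hm : 0 < m) (τ : Equiv.Perm (Fin m)) {S₁ : Finset ℕ}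
    (S₂ : Finset ℕ) (h₁ : S₁ ∈ markSets m a) :
    markWeight τ (a + b) (S₁ ∪ shift a S₂) = markWeight τ a S₁ * markWeight τ b S₂ := by
  have hdisj : Disjoint S₁ (shift a S₂) := by
    refine disjoint_left.2 fun x hx hx' => ?_
    have := add_le_of_mem_markSets h₁ hx
    obtain ⟨y, hy, rfl⟩ := mem_shift.1 hx'
    omega
  have hfact : ((markCount τ (a + b) (S₁ ∪ shift a S₂) : ℕ) : ℚ) / ((a + b).factorial : ℚ) =
      (markCount τ a S₁ : ℚ) / (a.factorial : ℚ) * ((markCount τ b S₂ : ℚ) / (b.factorial : ℚ)) := by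
    rw [markCount_union τ S₂ h₁, Nat.cast_mul, Nat.cast_add_choose]
    have h1 : ((a + b).factorial : ℚ) ≠ 0 := by positivity
    have h2 : (a.factorial : ℚ) ≠ 0 := by positivity
    have h3 : (b.factorial : ℚ) ≠ 0 := by positivity
    push_cast
    field_simp
  rw [markWeight, markWeight, markWeight, hfact, card_union_of_disjoint hdisj, card_map, pow_add,
    Polynomial.C_mul]
  ring

theorem coeff_occurrenceSeries {m : ℕ} (hm : 0 < m) (τ : Equiv.Perm (Fin m)) (n : ℕ) :
    PowerSeries.coeff n (occurrenceSeries τ) = ∑ S ∈ markSets m n, markWeight τ n S := by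
  classical
  let occ (σ : Equiv.Perm (Fin n)) : Finset ℕ := {i ∈ range (n + 1 - m) | OccursAt τ σ i}
  have hocc (σ) : numOccurrences τ σ = #(occ σ) := by
    rw [numOccurrences, Nat.card_eq_fintype_card, Fintype.card_subtype]
    refine card_bij (fun i _ => (i : ℕ)) (fun i hi => ?_) (fun i _ j _ => Fin.ext) fun i hi => ?_
    · have := (mem_filter.1 hi).2
      exact mem_filter.2 ⟨mem_range.2 (by have := this.1; omega), this⟩
    · have h := (mem_filter.1 hi).2
      exact ⟨⟨i, by have := h.1; omega⟩, mem_filter.2 ⟨mem_univ _, h⟩, rfl⟩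
  have hle (σ) : #(occ σ) < n + 1 := by
    have := card_filter_le (range (n + 1 - m)) (fun i => OccursAt τ σ i)
    rw [card_range] at this
    exact lt_of_le_of_lt this (by omega)
  have hcount (k) : permCount τ n k = #{σ : Equiv.Perm (Fin n) | #(occ σ) = k} := by
    rw [permCount, ← Fintype.card_subtype, ← Nat.card_eq_fintype_card]
    simp_rw [hocc]
  have hmark (S) (hS : S ∈ markSets m n) :
      markCount τ n S = #{σ : Equiv.Perm (Fin n) | S ⊆ occ σ} := by
    rw [← card_perm_occursAt τ hS, ← Fintype.card_subtype, ← Nat.card_eq_fintype_card]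
    refine Nat.card_congr (Equiv.subtypeEquivRight fun σ => ?_)
    refine ⟨fun h x hx => mem_filter.2 ⟨mem_range.2 (mem_markSets.1 hS x hx), h x hx⟩,
      fun h x hx => (mem_filter.1 (h hx)).2⟩
  have hl : PowerSeries.coeff n (occurrenceSeries τ) =
      Polynomial.C ((n.factorial : ℚ)⁻¹) *
        ∑ σ : Equiv.Perm (Fin n), (Polynomial.X : Polynomial ℚ) ^ #(occ σ) := by
    rw [occurrenceSeries, PowerSeries.coeff_mk,
      ← sum_fiberwise_of_maps_to (g := fun σ => #(occ σ)) (t := range (n + 1))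
        (fun σ _ => mem_range.2 (hle σ)), mul_sum]
    refine sum_congr rfl fun k _ => ?_
    rw [sum_congr rfl (fun σ hσ => by rw [(mem_filter.1 hσ).2]), sum_const, hcount, div_eq_mul_inv,
      Polynomial.C_mul, nsmul_eq_mul]
    simp only [map_natCast]
    ring
  have hr : ∑ S ∈ markSets m n, markWeight τ n S =
      Polynomial.C ((n.factorial : ℚ)⁻¹) * ∑ S ∈ markSets m n,
        ∑ σ : Equiv.Perm (Fin n) with S ⊆ occ σ, (Polynomial.X - 1 : Polynomial ℚ) ^ #S := by
    rw [mul_sum]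
    refine sum_congr rfl fun S hS => ?_
    rw [sum_const, markWeight, hmark S hS, div_eq_mul_inv, Polynomial.C_mul, nsmul_eq_mul]
    simp only [map_natCast]
    ring
  rw [hl, hr]
  congr 1
  simp_rw [sum_filter]
  rw [sum_comm]
  refine sum_congr rfl fun σ _ => ?_
  rw [← sum_filter]
  have : {S ∈ markSets m n | S ⊆ occ σ} = (occ σ).powerset := by
    ext S
    rw [mem_filter, mem_powerset, and_iff_right_iff_imp]
    exact fun h => mem_powerset.2 (h.trans (filter_subset _ _))
  rw [this]
  -- Binomial expansion of `((t - 1) + 1) ^ #(occ σ)` over subsets of the occurrences.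
  have := sum_pow_mul_eq_add_pow (Polynomial.X - 1 : Polynomial ℚ) 1 (occ σ)
  simpa using this.symm

theorem markCount_empty_one {m : ℕ} (τ : Equiv.Perm (Fin m)) : markCount τ 1 ∅ = 1 := by
  refine Eq.trans ?_ (linExt_chain 1)
  refine linExt_congr (Equiv.refl _) fun s _ => ⟨fun _ x y h => ?_, fun _ x y h => ?_⟩
  · omega
  · obtain ⟨i, hi, -⟩ := h
    simp at hi

theorem blocks_one {m : ℕ} (hm : 2 ≤ m) : blocks m 1 = {∅} := by
  ext S
  rw [mem_blocks, mem_singleton]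
  constructor
  · rintro ⟨h, -⟩
    refine eq_empty_of_forall_notMem fun x hx => ?_
    have := add_le_of_mem_markSets h hx
    omega
  · rintro rfl
    exact ⟨empty_mem_powerset _, one_pos, fun p h1 h2 => by omega⟩

/-- The summand `X` accounts for the `0`-cluster, the empty block of length one. Longer blocks
contain `0`, so they have at least one mark. -/
theorem coeff_clusterSeries {m : ℕ} (hm : 2 ≤ m) (τ : Equiv.Perm (Fin m)) (n : ℕ) :
    PowerSeries.coeff n (PowerSeries.X + shiftedClusterSeries τ) =
      ∑ S ∈ blocks m n, markWeight τ n S := by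
  rw [map_add, PowerSeries.coeff_X, shiftedClusterSeries, PowerSeries.coeff_mk]
  rcases Nat.lt_or_ge n 2 with hn | hn
  · interval_cases n
    · simp [blocks]
    · simp [blocks_one hm, markWeight, markCount_empty_one]
  · rw [if_neg (by omega), if_pos hn, zero_add]
    have hmaps : ∀ S ∈ blocks m n, #S ∈ Icc 1 n := fun S hS => by
      have h1 := card_pos.2 ⟨0, zero_mem_of_mem_blocks hS hn⟩
      have h2 := card_le_card (mem_powerset.1 (mem_blocks.1 hS).1)
      rw [card_range] at h2
      exact mem_Icc.2 ⟨h1, by omega⟩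
    rw [← sum_fiberwise_of_maps_to hmaps]
    refine sum_congr rfl fun l _ => ?_
    rw [clusterNumber_eq_sum hm, Nat.cast_sum, sum_div, map_sum, sum_mul]
    refine sum_congr rfl fun S hS => ?_
    rw [markWeight, (mem_filter.1 hS).2]

/-- The cluster method of Goulden and Jackson for a single consecutive pattern. -/
theorem occurrenceSeries_mul {m : ℕ} (hm : 2 ≤ m) (τ : Equiv.Perm (Fin m)) :
    occurrenceSeries τ * (1 - PowerSeries.X - shiftedClusterSeries τ) = 1 := by
  have key : occurrenceSeries τ =
      1 + (PowerSeries.X + shiftedClusterSeries τ) * occurrenceSeries τ := by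
    ext1 n
    rw [map_add, PowerSeries.coeff_mul, coeff_occurrenceSeries (by omega), PowerSeries.coeff_one]
    simp_rw [coeff_clusterSeries hm, coeff_occurrenceSeries (m := m) (by omega)]
    rcases Nat.eq_zero_or_pos n with rfl | hn
    · have h0 : markSets m 0 = {∅} := by
        rw [markSets, Nat.sub_eq_zero_of_le (by omega : 0 + 1 ≤ m), range_zero, powerset_empty]
      have h1 : markCount τ 0 ∅ = 1 := linExt_of_isEmpty _
      simp [h0, markWeight, h1, blocks]
    · rw [if_neg hn.ne', zero_add, sum_markSets (by omega) hn]
      refine sum_congr rfl fun z hz => ?_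
      rw [sum_mul_sum]
      refine sum_congr rfl fun S₁ h₁ => sum_congr rfl fun S₂ _ => ?_
      rw [← HasAntidiagonal.mem_antidiagonal.1 hz]
      exact markWeight_union (by omega) τ S₂ (mem_blocks.1 h₁).1
  linear_combination key

/-! ### Order relations forced by 1423 -/

theorem occRel_1423 {S : Finset ℕ} {x y : ℕ} :
    OccRel pattern1423 S x y ↔ ∃ i ∈ S, (x = i ∧ (y = i + 1 ∨ y = i + 2 ∨ y = i + 3)) ∨
      (x = i + 2 ∧ (y = i + 1 ∨ y = i + 3)) ∨ (x = i + 3 ∧ y = i + 1) := by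
  refine exists_congr fun i => and_congr_right fun _ => ⟨?_, ?_⟩
  · rintro ⟨a, b, h, rfl, rfl⟩
    fin_cases a <;> fin_cases b <;> simp [pattern1423] at h ⊢
  · rintro (⟨rfl, rfl | rfl | rfl⟩ | ⟨rfl, rfl | rfl⟩ | ⟨rfl, rfl⟩)
    · exact ⟨0, 1, by decide, rfl, rfl⟩
    · exact ⟨0, 2, by decide, rfl, rfl⟩
    · exact ⟨0, 3, by decide, rfl, rfl⟩
    · exact ⟨2, 1, by decide, rfl, rfl⟩
    · exact ⟨2, 3, by decide, rfl, rfl⟩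
    · exact ⟨3, 1, by decide, rfl, rfl⟩

/-- The extension of a relation on `Fin n` to `ℕ` by `False`. -/
def natRel {n : ℕ} (s : Fin n → Fin n → Prop) (x y : ℕ) : Prop :=
  ∃ (hx : x < n) (hy : y < n), s ⟨x, hx⟩ ⟨y, hy⟩

theorem natRel_trans {n : ℕ} {s : Fin n → Fin n → Prop} (hs : IsStrictTotalOrder (Fin n) s)
    {x y z : ℕ} : natRel s x y → natRel s y z → natRel s x z :=
  fun ⟨hx, _, h⟩ ⟨_, hz, h'⟩ => ⟨hx, hz, hs.trans _ _ _ h h'⟩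

theorem natRel_iff {n : ℕ} {s : Fin n → Fin n → Prop} {x y : Fin n} :
    natRel s x y ↔ s x y :=
  ⟨fun ⟨_, _, h⟩ => h, fun h => ⟨x.2, y.2, h⟩⟩

theorem forall_occRel_iff {m n : ℕ} {τ : Equiv.Perm (Fin m)} {S : Finset ℕ}
    (hS : S ∈ markSets m n) {s : Fin n → Fin n → Prop} :
    (∀ x y : Fin n, OccRel τ S x y → s x y) ↔ ∀ x y, OccRel τ S x y → natRel s x y := by
  refine ⟨fun h x y hxy => ?_, fun h x y hxy => natRel_iff.1 (h x y hxy)⟩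
  obtain ⟨i, hi, a, b, -, hx, hy⟩ := id hxy
  have := add_le_of_mem_markSets hS hi
  exact ⟨by omega, by omega, h ⟨x, by omega⟩ ⟨y, by omega⟩ hxy⟩

/-- The first letter of 1423 is its smallest: from `y`, pass to the start of a mark crossing the gap
before `y`, and descend to `0`. -/
theorem first_lt_of_mem_blocks {n : ℕ} {S : Finset ℕ} (hS : S ∈ blocks 4 n) {R : ℕ → ℕ → Prop}
    (htrans : ∀ {x y z}, R x y → R y z → R x z) (hR : ∀ x y, OccRel pattern1423 S x y → R x y)
    {y : ℕ} (hy : 0 < y) (hyn : y < n) : R 0 y := by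
  induction y using Nat.strong_induction_on with
  | _ y ih =>
    obtain ⟨x, hx, h1, h2⟩ := (mem_blocks.1 hS).2.2 y hy hyn
    have hxy : R x y := hR x y (occRel_1423.2 ⟨x, hx, Or.inl ⟨rfl, by omega⟩⟩)
    rcases Nat.eq_zero_or_pos x with rfl | hx0
    · exact hxy
    · exact htrans (ih x h1 hx0 (h1.trans hyn)) hxy

theorem markCount_eq_linExt_tail {b : ℕ} {S : Finset ℕ} (hS : S ∈ blocks 4 (b + 1)) :
    markCount pattern1423 (b + 1) S =
      linExt (fun x y : Fin b => OccRel pattern1423 S (x + 1) (y + 1)) := by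
  rw [← linExt_ordinalSum 1, markCount]
  symm
  refine linExt_congr (finSumFinEquiv.trans (finCongr (Nat.add_comm 1 b))) fun s hs => ?_
  rw [forall_occRel_iff (mem_blocks.1 hS).1]
  constructor
  · intro h x y hxy
    have hR : ∀ z w, Sum.Lex (fun i j : Fin 1 => i < j)
        (fun x y : Fin b => OccRel pattern1423 S (x + 1) (y + 1)) z w →
        natRel s (finSumFinEquiv.trans (finCongr (Nat.add_comm 1 b)) z)
          (finSumFinEquiv.trans (finCongr (Nat.add_comm 1 b)) w) :=
      fun z w hzw => natRel_iff.2 (h z w hzw)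
    obtain ⟨i, hi, hi'⟩ := occRel_1423.1 hxy
    have := add_le_of_mem_markSets (mem_blocks.1 hS).1 hi
    rcases Nat.eq_zero_or_pos x with rfl | hx
    · have := hR (Sum.inl 0) (Sum.inr ⟨y - 1, by omega⟩) (Sum.Lex.sep _ _)
      simpa [show 1 + (y - 1) = y by omega] using this
    · have := hR (Sum.inr ⟨x - 1, by omega⟩) (Sum.inr ⟨y - 1, by omega⟩) (Sum.Lex.inr (by
        simpa [show x - 1 + 1 = x by omega, show y - 1 + 1 = y by omega] using hxy))
      simpa [show 1 + (y - 1) = y by omega, show 1 + (x - 1) = x by omega] using this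
  · rintro h _ _ (h' | h' | ⟨i, y⟩)
    · omega
    · refine natRel_iff.1 (h _ _ ?_)
      simpa [Nat.add_comm 1] using h'
    · refine natRel_iff.1 ?_
      have := first_lt_of_mem_blocks hS (R := natRel s) (natRel_trans hs) h (y := y + 1)
        (by omega) (by omega)
      simpa [Nat.add_comm 1] using this

/-! ### Runs of occurrences at distance two -/

/-- The first `k` even numbers. -/
def evens (k : ℕ) : Finset ℕ := (range k).image (2 * ·)

theorem mem_evens {k x : ℕ} : x ∈ evens k ↔ ∃ j < k, 2 * j = x := by
  simp [evens]

/-- The positions of the letters of a word that starts with a run of `k` occurrences of `1423`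
at distance two: the small letters of the run, its large letters, and the rest. -/
def runPos (k b : ℕ) : Fin (k + 2) ⊕ (Fin k ⊕ Fin b) → ℕ
  | Sum.inl i => if (i : ℕ) ≤ k then 2 * i else 2 * k + 1
  | Sum.inr (Sum.inl j) => 2 * (k - 1 - j) + 1
  | Sum.inr (Sum.inr y) => 2 * k + 2 + y

theorem runPos_lt {k b : ℕ} (z : Fin (k + 2) ⊕ (Fin k ⊕ Fin b)) :
    runPos k b z < 2 * k + 2 + b := by
  rcases z with i | j | y
  · simp only [runPos]
    split_ifs <;> omega
  · simp only [runPos]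
    omega
  · simp only [runPos]
    omega

theorem runPos_injective (k b : ℕ) : Function.Injective (runPos k b) := by
  rintro (i | j | y) (i' | j' | y') h <;> simp only [runPos] at h
  · rw [Sum.inl.injEq, Fin.ext_iff]
    split_ifs at h <;> omega
  · split_ifs at h <;> omega
  · split_ifs at h <;> omega
  · split_ifs at h <;> omega
  · rw [Sum.inr.injEq, Sum.inl.injEq, Fin.ext_iff]
    omega
  · omega
  · split_ifs at h <;> omega
  · omega
  · rw [Sum.inr.injEq, Sum.inr.injEq, Fin.ext_iff]
    omega

/-- `runPos` as an equivalence. -/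
noncomputable def runEquiv (k b : ℕ) :
    Fin (k + 2) ⊕ (Fin k ⊕ Fin b) ≃ Fin (2 * k + 2 + b) :=
  Equiv.ofBijective (fun z => ⟨runPos k b z, runPos_lt z⟩)
    ((Fintype.bijective_iff_injective_and_card _).2
      ⟨fun _ _ h => runPos_injective k b (Fin.ext_iff.1 h), by simp; omega⟩)

theorem run_union_mem_blocks {k b : ℕ} (hk : 0 < k) {S : Finset ℕ} (hS : S ∈ blocks 4 (b + 1)) :
    evens k ∪ shift (2 * k + 1) S ∈ blocks 4 (2 * k + 2 + b) := by
  refine mem_blocks.2 ⟨mem_markSets.2 fun x hx => ?_, by omega, fun p hp hpn => ?_⟩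
  · rcases mem_union.1 hx with hx | hx
    · obtain ⟨j, hj, rfl⟩ := mem_evens.1 hx
      omega
    · obtain ⟨y, hy, rfl⟩ := mem_shift.1 hx
      have := add_le_of_mem_markSets (mem_blocks.1 hS).1 hy
      omega
  · rcases Nat.lt_or_ge (2 * k + 1) p with h | h
    · obtain ⟨x, hx, h1, h2⟩ := (mem_blocks.1 hS).2.2 (p - (2 * k + 1)) (by omega) (by omega)
      exact ⟨2 * k + 1 + x, mem_union_right _ (mem_shift.2 ⟨x, hx, rfl⟩), by omega, by omega⟩
    -- The largest even number below `p`, capped at the last mark of the run, whose factor ends at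
    -- gap `2k+2`.
    · refine ⟨2 * min ((p - 1) / 2) (k - 1),
        mem_union_left _ (mem_evens.2 ⟨_, by omega, rfl⟩), by omega, by omega⟩

/-- Letters `0, 2, …, 2k, 2k+1` form a bottom chain. Above it are the chain of letters `2k-1, …, 3,
1`, in increasing order of value, and the cluster on `S` without its minimal first letter, which is
letter `2k+1`. The last two are independent, whence the binomial coefficient. -/
theorem markCount_run {k b : ℕ} (hk : 0 < k) {S : Finset ℕ} (hS : S ∈ blocks 4 (b + 1)) :
    markCount pattern1423 (2 * k + 2 + b) (evens k ∪ shift (2 * k + 1) S) =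
      (k + b).choose k * markCount pattern1423 (b + 1) S := by
  have hsum := linExt_liftRel (fun i j : Fin k => i < j)
    (fun x y : Fin b => OccRel pattern1423 S (x + 1) (y + 1))
  rw [linExt_chain, one_mul, Fintype.card_fin, Fintype.card_fin, ← markCount_eq_linExt_tail hS]
    at hsum
  rw [← hsum, ← linExt_ordinalSum (k + 2), markCount]
  symm
  refine linExt_congr (runEquiv k b) fun s hs => ?_
  rw [forall_occRel_iff (mem_blocks.1 (run_union_mem_blocks hk hS)).1]
  have trans : ∀ {x y z : ℕ}, natRel s x y → natRel s y z → natRel s x z := natRel_trans hs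
  have hval (z) : ((runEquiv k b z : Fin (2 * k + 2 + b)) : ℕ) = runPos k b z := rfl
  constructor
  · intro h
    replace h : ∀ z w, _ → natRel s (runPos k b z) (runPos k b w) := fun z w hzw =>
      natRel_iff.2 (h z w hzw)
    have hodd (v : ℕ) (hv : v % 2 = 1) (hvk : v < 2 * k) :
        runPos k b (Sum.inr (Sum.inl ⟨k - 1 - v / 2, by omega⟩)) = v := by
      simp only [runPos]
      omega
    have hrest (v : ℕ) (hv : 2 * k + 2 ≤ v) (hvn : v < 2 * k + 2 + b) :
        runPos k b (Sum.inr (Sum.inr ⟨v - (2 * k + 2), by omega⟩)) = v := by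
      simp only [runPos]
      omega
    have heven (j : ℕ) (hj : j ≤ k) : runPos k b (Sum.inl ⟨j, by omega⟩) = 2 * j := by
      simp only [runPos]
      rw [if_pos hj]
    have hlast : runPos k b (Sum.inl ⟨k + 1, by omega⟩) = 2 * k + 1 := by
      simp [runPos]
    -- Small letters of the run lie below all letters to their right and all letters at odd
    -- positions.
    have hA (j v : ℕ) (hj : j ≤ k) (hv : 2 * j < v ∨ v % 2 = 1) (hvn : v < 2 * k + 2 + b) :
        natRel s (2 * j) v := by
      rw [← heven j hj]
      rcases Nat.lt_or_ge v (2 * k + 2) with hvk | hvk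
      · rcases Nat.mod_two_eq_zero_or_one v with h0 | h0
        · have := heven (v / 2) (by omega)
          rw [show 2 * (v / 2) = v by omega] at this
          rw [← this]
          exact h _ _ (Sum.Lex.inl (by rw [Fin.mk_lt_mk]; omega))
        · rcases Nat.lt_or_ge v (2 * k) with h1 | h1
          · rw [← hodd v h0 h1]
            exact h _ _ (Sum.Lex.sep _ _)
          · rw [show v = 2 * k + 1 by omega, ← hlast]
            exact h _ _ (Sum.Lex.inl (by rw [Fin.mk_lt_mk]; omega))
      · rw [← hrest v hvk hvn]
        exact h _ _ (Sum.Lex.sep _ _)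
    have hB (v : ℕ) (hv : 2 * k + 2 ≤ v ∨ v % 2 = 1 ∧ v < 2 * k) (hvn : v < 2 * k + 2 + b) :
        natRel s (2 * k + 1) v := by
      rw [← hlast]
      rcases hv with hv | ⟨hv, hvk⟩
      · rw [← hrest v hv hvn]
        exact h _ _ (Sum.Lex.sep _ _)
      · rw [← hodd v hv hvk]
        exact h _ _ (Sum.Lex.sep _ _)
    intro x y hxy
    obtain ⟨i, hi, hi'⟩ := occRel_1423.1 hxy
    rcases mem_union.1 hi with hi | hi
    · obtain ⟨j, hj, rfl⟩ := mem_evens.1 hi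
      rcases hi' with ⟨rfl, hy⟩ | ⟨rfl, hy⟩ | ⟨rfl, rfl⟩
      · exact hA j y hj.le (by omega) (by omega)
      · exact hA (j + 1) y hj (by omega) (by omega)
      -- In the last occurrence of the run, letter `2j+3` is `2k+1`, the top of the bottom chain
      -- rather than a large letter.
      · rcases Nat.lt_or_ge (j + 1) k with hjk | hjk
        · have := h (Sum.inr (Sum.inl ⟨k - 1 - (2 * j + 3) / 2, by omega⟩))
            (Sum.inr (Sum.inl ⟨k - 1 - (2 * j + 1) / 2, by omega⟩))
            (Sum.Lex.inr (Sum.LiftRel.inl (by rw [Fin.mk_lt_mk]; omega)))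
          rwa [hodd (2 * j + 3) (by omega) (by omega),
            hodd (2 * j + 1) (by omega) (by omega)] at this
        · rw [show 2 * j + 3 = 2 * k + 1 by omega]
          exact hB _ (by omega) (by omega)
    · obtain ⟨j, hj, rfl⟩ := mem_shift.1 hi
      have := add_le_of_mem_markSets (mem_blocks.1 hS).1 hj
      rcases Nat.lt_or_ge x (2 * k + 2) with hx | hx
      · rw [show x = 2 * k + 1 by omega]
        exact hB y (by omega) (by omega)
      · have := h (Sum.inr (Sum.inr ⟨x - (2 * k + 2), by omega⟩))
          (Sum.inr (Sum.inr ⟨y - (2 * k + 2), by omega⟩))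
          (Sum.Lex.inr (Sum.LiftRel.inr (occRel_1423.2 ⟨j, hj, by dsimp only; omega⟩)))
        rwa [hrest x hx (by omega), hrest y (by omega) (by omega)] at this
  · intro h
    have hE (i x y : ℕ) (hi : i < k) (hxy : (x = 2 * i ∧ y = 2 * i + 2) ∨
        (x = 2 * i + 2 ∧ y = 2 * i + 3) ∨ (x = 2 * i + 3 ∧ y = 2 * i + 1)) : natRel s x y :=
      h x y (occRel_1423.2 ⟨2 * i, mem_union_left _ (mem_evens.2 ⟨i, hi, rfl⟩), by omega⟩)
    have hS' (x y : ℕ) (hxy : OccRel pattern1423 S x y) :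
        natRel s (2 * k + 1 + x) (2 * k + 1 + y) := by
      obtain ⟨i, hi, hi'⟩ := occRel_1423.1 hxy
      exact h _ _ (occRel_1423.2
        ⟨2 * k + 1 + i, mem_union_right _ (mem_shift.2 ⟨i, hi, rfl⟩), by omega⟩)
    have heven (i j : ℕ) (hij : i < j) (hj : j ≤ k) : natRel s (2 * i) (2 * j) := by
      induction j, hij using Nat.le_induction with
      | base => exact hE i _ _ (by omega) (by omega)
      | succ j hij ih => exact trans (ih (by omega)) (hE j _ _ (by omega) (by omega))
    have hodd (i j : ℕ) (hij : i < j) (hj : j ≤ k) : natRel s (2 * j + 1) (2 * i + 1) := by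
      induction j, hij using Nat.le_induction with
      | base => exact hE i _ _ (by omega) (by omega)
      | succ j hij ih => exact trans (hE j _ _ (by omega) (by omega)) (ih (by omega))
    have hlast (i : ℕ) (hi : i ≤ k) : natRel s (2 * i) (2 * k + 1) := by
      have hk1 : natRel s (2 * k) (2 * k + 1) := hE (k - 1) _ _ (by omega) (by omega)
      rcases hi.lt_or_eq with hi | rfl
      · exact trans (heven i k hi le_rfl) hk1
      · exact hk1
    have hmin (z : Fin k ⊕ Fin b) : natRel s (2 * k + 1) (runPos k b (Sum.inr z)) := by
      rcases z with j | y
      · exact hodd _ _ (by omega) le_rfl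
      · have := first_lt_of_mem_blocks hS
          (R := fun x y => natRel s (2 * k + 1 + x) (2 * k + 1 + y)) trans hS'
          (y := y + 1) (by omega) (by omega)
        have hy : runPos k b (Sum.inr (Sum.inr y)) = 2 * k + 1 + (y + 1) := by
          simp only [runPos]
          omega
        rwa [hy]
    intro z w hzw
    refine natRel_iff.1 ?_
    rw [hval, hval]
    rcases hzw with @⟨i, j, hij⟩ | h' | ⟨i, z⟩
    · rw [Fin.lt_def] at hij
      simp only [runPos]
      rw [if_pos (by omega)]
      split_ifs with hj
      · exact heven _ _ hij hj
      · exact hlast _ (by omega)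
    · rcases h' with @⟨i, j, hij⟩ | @⟨x, y, hxy⟩
      · rw [Fin.lt_def] at hij
        exact hodd _ _ (by omega) (by omega)
      · have := hS' _ _ hxy
        convert this using 1 <;> simp only [runPos] <;> omega
    · by_cases hi : (i : ℕ) ≤ k
      · refine trans ?_ (hmin z)
        simp only [runPos]
        rw [if_pos hi]
        exact hlast _ hi
      · have hi' : runPos k b (Sum.inl i) = 2 * k + 1 := by
          simp only [runPos]
          rw [if_neg hi]
        rw [hi']
        exact hmin z

/-! ### The recurrence for cluster numbers -/

theorem markCount_eq_zero_of_adjacent {n i : ℕ} {S : Finset ℕ} (hS : S ∈ markSets 4 n)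
    (hi : i ∈ S) (hi' : i + 1 ∈ S) : markCount pattern1423 n S = 0 := by
  have : IsEmpty {s : Fin n → Fin n → Prop // IsStrictTotalOrder (Fin n) s ∧
      ∀ x y : Fin n, OccRel pattern1423 S x y → s x y} := by
    refine ⟨fun ⟨s, hs, h⟩ => ?_⟩
    have h' := (forall_occRel_iff hS).1 h
    -- Letters `i+2`, `i+3` play 2, 3 in the first occurrence but 4, 2 in the second.
    obtain ⟨hx, _, h0⟩ := natRel_trans hs
      (h' (i + 2) (i + 3) (occRel_1423.2 ⟨i, hi, by omega⟩))
      (h' (i + 3) (i + 2) (occRel_1423.2 ⟨i + 1, hi', by omega⟩))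
    exact hs.irrefl _ h0
  exact Nat.card_of_isEmpty

/-- The number `2k` is the least even number missing from the union, so `k` and then `S` can be read
off. -/
theorem run_union_inj {k k' : ℕ} {S T : Finset ℕ}
    (h : evens k ∪ shift (2 * k + 1) S = evens k' ∪ shift (2 * k' + 1) T) : k = k' ∧ S = T := by
  have hmem {k : ℕ} {S : Finset ℕ} (x : ℕ) : x ∈ evens k ∪ shift (2 * k + 1) S ↔
      (x % 2 = 0 ∧ x < 2 * k) ∨ (2 * k + 1 ≤ x ∧ x - (2 * k + 1) ∈ S) := by
    rw [mem_union, mem_evens, mem_shift]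
    refine or_congr ⟨?_, fun h => ⟨x / 2, by omega, by omega⟩⟩ ⟨?_, fun h => ⟨_, h.2, by omega⟩⟩
    · rintro ⟨j, hj, rfl⟩
      omega
    · rintro ⟨y, hy, rfl⟩
      exact ⟨by omega, by rwa [Nat.add_sub_cancel_left]⟩
  have key (x : ℕ) := (hmem x).symm.trans ((Finset.ext_iff.1 h x).trans (hmem x))
  obtain rfl : k = k' := by
    have h1 := key (2 * k)
    have h2 := key (2 * k')
    by_contra hne
    rcases Nat.lt_or_gt_of_ne hne with hlt | hlt
    · have := h1.2 (Or.inl (by omega))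
      omega
    · have := h2.1 (Or.inl (by omega))
      omega
  refine ⟨rfl, Finset.ext fun y => ?_⟩
  have := key (2 * k + 1 + y)
  rw [Nat.add_sub_cancel_left] at this
  constructor
  · intro hy
    rcases this.1 (Or.inr ⟨by omega, hy⟩) with h' | h'
    · omega
    · exact h'.2
  · intro hy
    rcases this.2 (Or.inr ⟨by omega, hy⟩) with h' | h'
    · omega
    · exact h'.2

theorem exists_run_of_mem_blocks {n : ℕ} (hn : 2 ≤ n) {S : Finset ℕ} (hS : S ∈ blocks 4 n)
    (hadj : ∀ i ∈ S, i + 1 ∉ S) :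
    ∃ k T, 0 < k ∧ 2 * k + 2 ≤ n ∧ T ∈ blocks 4 (n - 2 * k - 1) ∧
      evens k ∪ shift (2 * k + 1) T = S := by
  have hle (x) (hx : x ∈ S) := add_le_of_mem_markSets (mem_blocks.1 hS).1 hx
  have hex : ∃ k, 2 * k ∉ S := ⟨n, fun h => by have := hle _ h; omega⟩
  classical
  have hk := Nat.find_spec hex
  have hlt : ∀ j < Nat.find hex, 2 * j ∈ S := fun j hj => not_not.1 (Nat.find_min hex hj)
  generalize Nat.find hex = k at *
  have hk0 : 0 < k := by
    by_contra hk0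
    have h0 := zero_mem_of_mem_blocks hS hn
    rw [show 2 * k = 0 by omega] at hk
    exact hk h0
  have hkn := hle _ (hlt (k - 1) (by omega))
  -- An odd mark here would be adjacent to the even mark just before it.
  have hsmall (x : ℕ) (hx : x ∈ S) (hxk : x < 2 * k + 1) : ∃ j < k, 2 * j = x := by
    refine ⟨x / 2, ?_, ?_⟩
    · by_contra h
      exact hk (by rwa [show 2 * k = x by omega])
    · by_contra h
      refine hadj (2 * (x / 2)) (hlt _ (by omega)) ?_
      rwa [show 2 * (x / 2) + 1 = x by omega]
  refine ⟨k, {x ∈ range n | 2 * k + 1 + x ∈ S}, hk0, by omega, mem_blocks.2 ⟨?_, by omega, ?_⟩, ?_⟩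
  · refine mem_markSets.2 fun x hx => ?_
    have := hle _ (mem_filter.1 hx).2
    omega
  · intro p hp hpn
    -- Factors of the run end at gap `2k+2` at the latest, so a mark crossing this gap belongs to
    -- the remainder.
    obtain ⟨x, hx, h1, h2⟩ := (mem_blocks.1 hS).2.2 (2 * k + 1 + p) (by omega) (by omega)
    rcases Nat.lt_or_ge x (2 * k + 1) with h | h
    · obtain ⟨j, hj, rfl⟩ := hsmall x hx h
      omega
    · exact ⟨x - (2 * k + 1), mem_filter.2 ⟨mem_range.2 (by omega),
        by rwa [Nat.add_sub_cancel' h]⟩, by omega, by omega⟩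
  · ext x
    rw [mem_union, mem_evens, mem_shift]
    constructor
    · rintro (⟨j, hj, rfl⟩ | ⟨y, hy, rfl⟩)
      · exact hlt j hj
      · exact (mem_filter.1 hy).2
    · intro hx
      rcases Nat.lt_or_ge x (2 * k + 1) with h | h
      · exact Or.inl (hsmall x hx h)
      · have := hle x hx
        exact Or.inr ⟨x - (2 * k + 1), mem_filter.2 ⟨mem_range.2 (by omega),
          by rwa [Nat.add_sub_cancel' h]⟩, by omega⟩

theorem card_run_union (k : ℕ) (S : Finset ℕ) :
    #(evens k ∪ shift (2 * k + 1) S) = k + #S := by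
  rw [card_union_of_disjoint, card_map, evens, card_image_of_injective, card_range]
  · exact fun x y h => by simpa using h
  · refine disjoint_left.2 fun x hx hx' => ?_
    obtain ⟨j, hj, rfl⟩ := mem_evens.1 hx
    obtain ⟨y, hy, h⟩ := mem_shift.1 hx'
    omega

theorem clusterNumber_1423 {n : ℕ} (hn : 4 ≤ n) (l : ℕ) :
    clusterNumber pattern1423 n l =
      ∑ k ∈ (range (n + 1)).filter (fun k => 4 ≤ 2 * k + 2 ∧ 2 * k + 2 ≤ n),
        Nat.choose (n - k - 2) k *
          (if k ≤ l then clusterNumber pattern1423 (n - 2 * k - 1) (l - k) else 0) := by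
  have hr (k : ℕ) : Nat.choose (n - k - 2) k *
      (if k ≤ l then clusterNumber pattern1423 (n - 2 * k - 1) (l - k) else 0) =
      ∑ T ∈ blocks 4 (n - 2 * k - 1) with k + #T = l,
        Nat.choose (n - k - 2) k * markCount pattern1423 (n - 2 * k - 1) T := by
    rw [← mul_sum]
    congr 1
    split_ifs with h
    · rw [clusterNumber_eq_sum (by norm_num)]
      congr 1
      ext T
      simp only [mem_filter]
      exact and_congr_right fun _ => by omega
    · rw [filter_false_of_mem (fun T _ => by omega), sum_empty]
  rw [sum_congr rfl (fun k _ => hr k), sum_sigma', clusterNumber_eq_sum (by norm_num)]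
  symm
  refine sum_of_injOn (fun z => evens z.1 ∪ shift (2 * z.1 + 1) z.2) ?_ ?_ ?_ ?_
  · rintro ⟨k, S⟩ - ⟨k', T⟩ - h
    obtain ⟨rfl, rfl⟩ := run_union_inj h
    rfl
  · rintro ⟨k, S⟩ h
    simp only [coe_sigma, Set.mem_sigma_iff, mem_coe, mem_filter] at h ⊢
    obtain ⟨⟨-, h1, h2⟩, hS, hc⟩ := h
    obtain ⟨b, rfl⟩ : ∃ b, n = 2 * k + 2 + b := ⟨n - (2 * k + 2), by omega⟩
    rw [show 2 * k + 2 + b - 2 * k - 1 = b + 1 by omega] at hS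
    exact ⟨run_union_mem_blocks (by omega) hS, (card_run_union k S).trans hc⟩
  -- Blocks not of the form run plus remainder contain adjacent marks and contribute zero.
  · intro S hS hnot
    by_contra hne
    obtain ⟨hS, hc⟩ := mem_filter.1 hS
    obtain ⟨k, T, hk, hkn, hT, rfl⟩ := exists_run_of_mem_blocks (by omega) hS fun i hi hi' =>
      hne (markCount_eq_zero_of_adjacent (mem_blocks.1 hS).1 hi hi')
    refine hnot ⟨⟨k, T⟩, ?_, rfl⟩
    rw [card_run_union] at hc
    simp only [coe_sigma, Set.mem_sigma_iff, mem_coe, mem_filter, mem_range]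
    exact ⟨⟨by omega, by omega, hkn⟩, hT, hc⟩
  · rintro ⟨k, S⟩ h
    simp only [mem_sigma, mem_filter] at h ⊢
    obtain ⟨⟨-, h1, h2⟩, hS, hc⟩ := h
    obtain ⟨b, rfl⟩ : ∃ b, n = 2 * k + 2 + b := ⟨n - (2 * k + 2), by omega⟩
    rw [show 2 * k + 2 + b - 2 * k - 1 = b + 1 by omega] at hS ⊢
    rw [markCount_run (by omega) hS, show 2 * k + 2 + b - k - 2 = k + b by omega]

/-! ### Initial values -/

theorem clusterNumber_eq_zero_of_lt {m n : ℕ} (hm : 2 ≤ m) (τ : Equiv.Perm (Fin m)) (h2 : 2 ≤ n)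
    (hn : n < m) (l : ℕ) : clusterNumber τ n l = 0 := by
  rw [clusterNumber_eq_sum hm]
  refine sum_eq_zero fun S hS => ?_
  have hS' := (mem_filter.1 hS).1
  have := add_le_of_mem_markSets (mem_blocks.1 hS').1 (zero_mem_of_mem_blocks hS' h2)
  omega

theorem clusterNumber_one {m : ℕ} (hm : 2 ≤ m) (τ : Equiv.Perm (Fin m)) (l : ℕ) :
    clusterNumber τ 1 l = if l = 0 then 1 else 0 := by
  rw [clusterNumber_eq_sum hm, blocks_one hm, sum_filter, sum_singleton, card_empty,
    markCount_empty_one]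
  simp only [eq_comm]

end ConsecutivePattern

theorem mainTheorem5 :
    (∀ l : ℕ, ConsecutivePattern.clusterNumber ConsecutivePattern.pattern1423 1 l
        = if l = 0 then 1 else 0) ∧
    (∀ l : ℕ, ConsecutivePattern.clusterNumber ConsecutivePattern.pattern1423 2 l = 0) ∧
    (∀ l : ℕ, ConsecutivePattern.clusterNumber ConsecutivePattern.pattern1423 3 l = 0) ∧
    (∀ n l : ℕ, 4 ≤ n →
      ConsecutivePattern.clusterNumber ConsecutivePattern.pattern1423 n l
        = ∑ k ∈ (Finset.range (n + 1)).filter (fun k => 4 ≤ 2 * k + 2 ∧ 2 * k + 2 ≤ n),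
            Nat.choose (n - k - 2) k *
              (if k ≤ l then
                ConsecutivePattern.clusterNumber ConsecutivePattern.pattern1423
                  (n - 2 * k - 1) (l - k)
              else 0)) ∧
    ConsecutivePattern.occurrenceSeries ConsecutivePattern.pattern1423 *
      (1 - PowerSeries.X -
        ConsecutivePattern.shiftedClusterSeries ConsecutivePattern.pattern1423) = 1 :=
  ⟨ConsecutivePattern.clusterNumber_one (by norm_num) _,
    ConsecutivePattern.clusterNumber_eq_zero_of_lt (by norm_num) _ (by norm_num) (by norm_num),
    ConsecutivePattern.clusterNumber_eq_zero_of_lt (by norm_num) _ (by norm_num) (by norm_num),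
    fun _ l hn => ConsecutivePattern.clusterNumber_1423 hn l,
    ConsecutivePattern.occurrenceSeries_mul (by norm_num) _⟩
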